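/- Let $k$ be a field and let $a\ge 3$, $d\ge 2$ be integers with $\gcd(a,d)=1$. Write $a=dq+r$ with integers $q\ge 0$ and $1\le r\le d-1$, and suppose that $q+r\ge d-2$. Let $H=\langle a,a+1,a+d\rangle=\{c_1a+c_2(a+1)+c_3(a+d)\mid c_1,c_2,c_3\in\mathbb{N}\}$, let $k[[H]]\subseteq k[[t]]$ be its numerical semigroup ring, that is, the ring of power series in $t$ all of whose exponents lie in $H$, and let $I$ be its defining ideal, that is, the kernel of the $k$-algebra homomorphism $\varphi:k[[x,y,z]]\to k[[H]]$ given by $\varphi(x)=t^{a}$, $\varphi(y)=t^{a+1}$, $\varphi(z)=t^{a+d}$. Then $I$ is the ideal generated by the $2\times 2$ minors of the matrix $$\begin{pmatrix} y^{r} & z & x^{q+r+2-d}\\ x^{d-1} & y^{d-r} & z^{q}\end{pmatrix}.$$ Let $F(H)$ denote the Frobenius number of $H$, i.e. the largest integer not in $H$, and call $H$ symmetric if $F(H)-m\in H$ for every integer $m\notin H$. If $H$ is not symmetric, then the following hold. 1. If $1\le r\le d-2$, then $F(H)=\dfrac{1}{d}a^2+\dfrac{d^2-2d-r}{d}\,a-(r+1)$.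 2. If $r=d-1$, then $F(H)=\dfrac{1}{d}a^2+\dfrac{d^2-3d+1}{d}\,a-1$. -/

import Mathlib

namespace NumSemigroup

/-- The semigroup `⟨n₁, …, nₑ⟩ = {c₁ n₁ + ⋯ + cₑ nₑ | cᵢ ∈ ℕ}`. -/
def semigroup {e : ℕ} (n : Fin e → ℕ) : AddSubmonoid ℕ :=
  AddSubmonoid.closure (Set.range n)

/-- The image in `ℤ` of a semigroup of natural numbers. -/
def toIntSet (H : AddSubmonoid ℕ) : Set ℤ := (fun m : ℕ => (m : ℤ)) '' (H : Set ℕ)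

/-- `H` is symmetric: the set of integers outside `H` has a greatest element `F` (the Frobenius
number) and `F - m ∈ H` for every integer `m ∉ H`. -/
def IsSymmetric (H : AddSubmonoid ℕ) : Prop :=
  ∃ F : ℤ, IsGreatest {m : ℤ | m ∉ toIntSet H} F ∧ ∀ m : ℤ, m ∉ toIntSet H → F - m ∈ toIntSet H

/-- The semigroup ring `k[[H]]`: power series in one variable `t` whose support lies in `H`. -/
def semigroupRing (k : Type*) [Field k] (H : AddSubmonoid ℕ) : Subalgebra k (PowerSeries k) where
  carrier := {f | ∀ m : ℕ, PowerSeries.coeff m f ≠ 0 → m ∈ H}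
  mul_mem' := by
    intro f g hf hg m hm
    rw [PowerSeries.coeff_mul] at hm
    obtain ⟨p, hp, hne⟩ := Finset.exists_ne_zero_of_sum_ne_zero hm
    rw [← Finset.HasAntidiagonal.mem_antidiagonal.mp hp]
    exact H.add_mem (hf _ (left_ne_zero_of_mul hne)) (hg _ (right_ne_zero_of_mul hne))
  add_mem' := by
    intro f g hf hg m hm
    by_cases h : PowerSeries.coeff m f = 0
    · exact hg m (by simpa [h] using hm)
    · exact hf m h
  algebraMap_mem' := by
    intro c m hm
    by_cases h : m = 0
    · exact h ▸ H.zero_mem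
    · exact absurd (by simp [PowerSeries.coeff_C, h]) hm

/-- The family `t^{n₁}, …, t^{nₑ}`, as power series in one variable
(recall that `PowerSeries k` is `MvPowerSeries Unit k`). -/
noncomputable def tPow (k : Type*) [Field k] {e : ℕ} (n : Fin e → ℕ) :
    Fin e → MvPowerSeries Unit k :=
  fun i => (PowerSeries.X ^ n i : PowerSeries k)

theorem hasSubst_tPow (k : Type*) [Field k] {e : ℕ} (n : Fin e → ℕ) (hn : ∀ i, 0 < n i) :
    MvPowerSeries.HasSubst (tPow k n) := by
  refine MvPowerSeries.hasSubst_of_constantCoeff_zero fun i => ?_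
  change PowerSeries.constantCoeff (PowerSeries.X ^ n i : PowerSeries k) = 0
  simp [(hn i).ne']

theorem subst_tPow_mem (k : Type*) [Field k] {e : ℕ} (n : Fin e → ℕ) (hn : ∀ i, 0 < n i)
    (f : MvPowerSeries (Fin e) k) :
    (MvPowerSeries.substAlgHom (hasSubst_tPow k n hn) f : PowerSeries k) ∈
      semigroupRing k (semigroup n) := by
  intro m hm
  rw [MvPowerSeries.substAlgHom_apply, PowerSeries.coeff,
    MvPowerSeries.coeff_subst (hasSubst_tPow k n hn)] at hm
  obtain ⟨c, hc⟩ := not_forall.mp fun h => hm (finsum_eq_zero_of_forall_eq_zero h)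
  have hmem : (c.prod fun s j => (tPow k n s) ^ j : PowerSeries k) ∈
      semigroupRing k (semigroup n) := by
    refine Subalgebra.prod_mem _ fun s _ => Subalgebra.pow_mem _ ?_ _
    intro j hj
    change PowerSeries.coeff j (PowerSeries.X ^ n s : PowerSeries k) ≠ 0 at hj
    rw [PowerSeries.coeff_X_pow] at hj
    have : j = n s := by
      by_contra h
      simp [h] at hj
    exact this ▸ AddSubmonoid.subset_closure ⟨s, rfl⟩
  exact hmem m fun h => hc (by
    change MvPowerSeries.coeff c f • PowerSeries.coeff m _ = 0
    rw [h, smul_zero])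

/-- The `k`-algebra homomorphism `φ : k[[x₁, …, xₑ]] → k[[H]]`, `φ(xᵢ) = t^{nᵢ}`, where
`H = ⟨n₁, …, nₑ⟩`: substitution of `t^{nᵢ}` for `xᵢ`. -/
noncomputable def phi (k : Type*) [Field k] {e : ℕ} (n : Fin e → ℕ) (hn : ∀ i, 0 < n i) :
    MvPowerSeries (Fin e) k →ₐ[k] semigroupRing k (semigroup n) :=
  AlgHom.codRestrict (B := PowerSeries k) (MvPowerSeries.substAlgHom (hasSubst_tPow k n hn))
    (semigroupRing k (semigroup n)) (subst_tPow_mem k n hn)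

theorem phi_X (k : Type*) [Field k] {e : ℕ} (n : Fin e → ℕ) (hn : ∀ i, 0 < n i) (i : Fin e) :
    (phi k n hn (MvPowerSeries.X i) : PowerSeries k) = PowerSeries.X ^ n i :=
  MvPowerSeries.substAlgHom_X (hasSubst_tPow k n hn) i

/-- The defining ideal of `k[[H]]`, `H = ⟨n₁, …, nₑ⟩`: the kernel of `φ`. -/
noncomputable def definingIdeal (k : Type*) [Field k] {e : ℕ} (n : Fin e → ℕ)
    (hn : ∀ i, 0 < n i) : Ideal (MvPowerSeries (Fin e) k) :=
  RingHom.ker (phi k n hn)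

/-- The ideal generated by the `2 × 2` minors of a matrix. -/
def minorsTwo {S : Type*} [CommRing S] {p q : ℕ} (M : Matrix (Fin p) (Fin q) S) : Ideal S :=
  Ideal.span {m | ∃ (f : Fin 2 ↪o Fin p) (g : Fin 2 ↪o Fin q), m = (M.submatrix f g).det}

theorem gens_pos {a : ℕ} (ha : 3 ≤ a) (d : ℕ) : ∀ i, 0 < ![a, a + 1, a + d] i := by
  intro i
  fin_cases i <;> simp <;> omega

end NumSemigroup

/-! Write x, y, z for the generators of degrees a, a+1, a+d. The minors give three rewriting rules:
y^d → z x^(d-1), y^r z^q → x^(q+r+1) and z^(q+1) → y^(d-r) x^(q+r+2-d). Each preserves weight, and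
together they reduce every monomial to x^i y^(s % d) z^(s / d) with s < a (`exists_normalForm`).
Such a monomial has weight s + a(i + s % d + s / d), so its weight recovers s modulo a, and then i
(`normalForm_injective`).

Hence monomials of equal weight agree modulo the minors. The kernel is spanned, weight by weight, by
differences of such monomials, which gives the ideal (`definingIdeal_eq_span`). The same normal form
shows that the Apéry set of H with respect to a is {s + (s % d + s / d)a : s < a}. Its maximum minus
a is the Frobenius number (`frobeniusNumber_of_isMax`). -/

namespace NumSemigroup

/-! ### Normal forms of monomials -/

open MvPowerSeries

/-- Any monomial in three elements satisfying the determinantal relations equals one in the normal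
form `x ^ i * y ^ (s % d) * z ^ (s / d)` with `s < a`. -/
theorem exists_normalForm {M : Type*} [CommMonoid M] {x y z : M} {a d q r : ℕ} (hd : 2 ≤ d)
    (ha : a = d * q + r) (hr1 : 1 ≤ r) (hr2 : r ≤ d - 1)
    (h1 : y ^ d = z * x ^ (d - 1)) (h2 : y ^ r * z ^ q = x ^ (q + r + 1))
    (h3 : z ^ (q + 1) = y ^ (d - r) * x ^ (q + r + 2 - d)) (i j l : ℕ) :
    ∃ i' s, s < a ∧ x ^ i * y ^ j * z ^ l = x ^ i' * y ^ (s % d) * z ^ (s / d) := by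
  -- Giving y cost 2 and z cost 2d - 1 makes all three rules decrease the cost: 2d > 2d - 1 for the
  -- first, and 2d - 1 > 2(d - r) for the third even if q = 0.
  induction hn : 2 * j + (2 * d - 1) * l using Nat.strong_induction_on generalizing i j l with
  | _ n ih =>
    subst hn
    obtain ⟨c, rfl⟩ : ∃ c, d = c + 1 := ⟨d - 1, by omega⟩
    have hc : 2 * (c + 1) - 1 = 2 * c + 1 := by omega
    rw [hc] at ih
    by_cases hj : c + 1 ≤ j
    · obtain ⟨j, rfl⟩ := Nat.exists_eq_add_of_le hj
      obtain ⟨i', s, hs, h⟩ := ih (2 * j + (2 * c + 1) * (l + 1)) (by nlinarith) (i + c) j (l + 1) rfl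
      refine ⟨i', s, hs, h ▸ ?_⟩
      rw [pow_add y, h1]
      simp only [pow_add, pow_one, Nat.add_sub_cancel]
      ac_rfl
    by_cases hl : q + 1 ≤ l
    · obtain ⟨l, rfl⟩ := Nat.exists_eq_add_of_le hl
      obtain ⟨b, hb⟩ : ∃ b, c + 1 = r + b := Nat.exists_eq_add_of_le (by omega)
      have hb' : c + 1 - r = b := by omega
      rw [hb'] at h3
      obtain ⟨i', s, hs, h⟩ := ih (2 * (j + b) + (2 * c + 1) * l) (by nlinarith)
        (i + (q + r + 2 - (c + 1))) (j + b) l rfl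
      refine ⟨i', s, hs, h ▸ ?_⟩
      rw [pow_add z, h3]
      simp only [pow_add]
      ac_rfl
    by_cases hjl : r ≤ j ∧ l = q
    · obtain ⟨hjr, rfl⟩ := hjl
      obtain ⟨j, rfl⟩ := Nat.exists_eq_add_of_le hjr
      obtain ⟨i', s, hs, h⟩ := ih (2 * j + (2 * c + 1) * 0) (by nlinarith)
        (i + (l + r + 1)) j 0 rfl
      refine ⟨i', s, hs, h ▸ ?_⟩
      rw [pow_add x i, ← h2]
      simp only [pow_add, pow_zero, mul_one]
      ac_rfl
    -- For an irreducible monomial, j < d and either l < q, or l = q and j < r: these are the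
    -- remainder and quotient by d of some s < dq + r = a.
    · have hm : (j + (c + 1) * l) % (c + 1) = j := by
        rw [Nat.add_mul_mod_self_left, Nat.mod_eq_of_lt (by omega)]
      have hq : (j + (c + 1) * l) / (c + 1) = l := by
        rw [Nat.add_mul_div_left _ _ (by omega), Nat.div_eq_of_lt (by omega), zero_add]
      refine ⟨i, j + (c + 1) * l, ?_, by rw [hm, hq]⟩
      rcases eq_or_ne l q with rfl | hne
      · have : j < r := by_contra fun h => hjl ⟨by omega, rfl⟩
        omega
      · have : l + 1 ≤ q := by omega
        nlinarith

/-- The weight of the normal form determines its exponents. -/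
theorem normalForm_injective {a d i s i' s' : ℕ} (hs : s < a) (hs' : s' < a)
    (h : i * a + (s % d) * (a + 1) + (s / d) * (a + d) =
      i' * a + (s' % d) * (a + 1) + (s' / d) * (a + d)) : i = i' ∧ s = s' := by
  have e : ∀ i s, i * a + (s % d) * (a + 1) + (s / d) * (a + d) =
      s + a * (i + s % d + s / d) := fun i s => by
    linear_combination Nat.mod_add_div s d
  rw [e, e] at h
  have hss : s = s' := by
    simpa [Nat.add_mul_mod_self_left, Nat.mod_eq_of_lt, hs, hs'] using congrArg (· % a) h
  subst hss
  have := Nat.eq_of_mul_eq_mul_left (by omega) (Nat.add_left_cancel h)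
  exact ⟨by omega, rfl⟩

/-! ### Homogeneity of the three relations -/

section Weight

variable {a d q r : ℕ}

theorem weight_rel_one (hd : 2 ≤ d) : d * (a + 1) = (a + d) + (d - 1) * a := by
  obtain ⟨c, rfl⟩ : ∃ c, d = c + 1 := ⟨d - 1, by omega⟩
  simp only [Nat.add_sub_cancel]
  ring

theorem weight_rel_two (ha : a = d * q + r) :
    r * (a + 1) + q * (a + d) = (q + r + 1) * a := by
  linear_combination -ha

theorem weight_rel_three (ha : a = d * q + r) (hd : 2 ≤ d) (hr2 : r ≤ d - 1)
    (hsum : d - 2 ≤ q + r) :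
    (q + 1) * (a + d) = (d - r) * (a + 1) + (q + r + 2 - d) * a := by
  obtain ⟨b, rfl⟩ : ∃ b, d = r + b := Nat.exists_eq_add_of_le (by omega)
  obtain ⟨e, he⟩ : ∃ e, q + r + 2 = r + b + e := Nat.exists_eq_add_of_le (by omega)
  rw [he, Nat.add_sub_cancel_left, Nat.add_sub_cancel_left]
  have he' : q + 2 = b + e := by omega
  zify at *
  linear_combination a * he' - ha

end Weight

/-! ### Apéry set and Frobenius number -/

/-- A natural number lies in `⟨a, a + 1, a + d⟩` iff it is at least the Apéry element of its
residue class modulo `a`. -/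
theorem mem_semigroup_iff {a d q r : ℕ} (hd : 2 ≤ d)
    (ha : a = d * q + r) (hr1 : 1 ≤ r) (hr2 : r ≤ d - 1) (hsum : d - 2 ≤ q + r) (m : ℕ) :
    m ∈ AddSubmonoid.closure (Set.range ![a, a + 1, a + d]) ↔
      ∃ i s, s < a ∧ m = i * a + (s % d) * (a + 1) + (s / d) * (a + d) := by
  have hrange : Set.range ![a, a + 1, a + d] = {a, a + 1, a + d} := by
    simp [Matrix.range_cons, Set.insert_def, Set.union_def]
  have key : m ∈ AddSubmonoid.closure (Set.range ![a, a + 1, a + d]) ↔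
      ∃ i j l, m = i * a + j * (a + 1) + l * (a + d) := by
    rw [hrange]
    simp only [Set.insert_eq, AddSubmonoid.closure_union, AddSubmonoid.mem_sup,
      AddSubmonoid.mem_closure_singleton, smul_eq_mul]
    constructor
    · rintro ⟨_, ⟨i, rfl⟩, _, ⟨_, ⟨j, rfl⟩, _, ⟨l, rfl⟩, rfl⟩, rfl⟩
      exact ⟨i, j, l, by ring⟩
    · rintro ⟨i, j, l, rfl⟩
      exact ⟨_, ⟨i, rfl⟩, _, ⟨_, ⟨j, rfl⟩, _, ⟨l, rfl⟩, rfl⟩, by ring⟩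
  rw [key]
  constructor
  · rintro ⟨i, j, l, rfl⟩
    -- Specialising x, y, z to their weights turns the rewriting into a statement about sums.
    obtain ⟨i', s, hs, h⟩ := exists_normalForm (M := Multiplicative ℕ)
      (x := .ofAdd a) (y := .ofAdd (a + 1)) (z := .ofAdd (a + d)) hd ha hr1 hr2
      (by simpa only [← ofAdd_nsmul, ← ofAdd_add, smul_eq_mul] using
        congrArg Multiplicative.ofAdd (weight_rel_one hd))
      (by simpa only [← ofAdd_nsmul, ← ofAdd_add, smul_eq_mul] using
        congrArg Multiplicative.ofAdd (weight_rel_two ha))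
      (by simpa only [← ofAdd_nsmul, ← ofAdd_add, smul_eq_mul] using
        congrArg Multiplicative.ofAdd (weight_rel_three ha hd hr2 hsum)) i j l
    refine ⟨i', s, hs, ?_⟩
    simpa only [← ofAdd_nsmul, ← ofAdd_add, smul_eq_mul, Multiplicative.ofAdd.injective.eq_iff]
      using h
  · rintro ⟨i, s, -, h⟩
    exact ⟨_, _, _, h⟩

/-- If `s₀ < a` maximises the Apéry element `s + (s % d + s / d) * a`, the Frobenius number of
`⟨a, a + 1, a + d⟩` is that element minus `a`. -/
theorem frobeniusNumber_of_isMax {a d q r s₀ F : ℕ} (hd : 2 ≤ d)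
    (ha : a = d * q + r) (hr1 : 1 ≤ r) (hr2 : r ≤ d - 1) (hsum : d - 2 ≤ q + r) (hs₀ : s₀ < a)
    (hmax : ∀ s < a, s + (s % d + s / d) * a ≤ s₀ + (s₀ % d + s₀ / d) * a)
    (hF : F + a = s₀ + (s₀ % d + s₀ / d) * a) :
    FrobeniusNumber F (Set.range ![a, a + 1, a + d]) := by
  have e : ∀ i s, i * a + (s % d) * (a + 1) + (s / d) * (a + d) =
      s + (s % d + s / d) * a + i * a := fun i s => by
    linear_combination Nat.mod_add_div s d
  constructor
  · intro h
    obtain ⟨i, s, hs, h⟩ := (mem_semigroup_iff hd ha hr1 hr2 hsum F).1 h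
    -- If F were in H, then F + a would have two normal forms, one with x-exponent i + 1 and one
    -- with 0.
    have h' : (i + 1) * a + (s % d) * (a + 1) + (s / d) * (a + d) =
        0 * a + (s₀ % d) * (a + 1) + (s₀ / d) * (a + d) := by
      rw [e] at h ⊢
      rw [e]
      linear_combination hF - h
    have := (normalForm_injective hs hs₀ h').1
    omega
  · intro m hm
    by_contra hlt
    refine hm ((mem_semigroup_iff hd ha hr1 hr2 hsum m).2 ?_)
    have hs : m % a < a := Nat.mod_lt _ (by omega)
    have hle : m % a + (m % a % d + m % a / d) * a < m + a := by
      have := hmax _ hs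
      omega
    have hdiv := Nat.mod_add_div m a
    -- The Apéry element of the class of m is congruent to m and less than m + a, hence at most m.
    have hq : m % a % d + m % a / d ≤ m / a := by
      by_contra hc
      have : (m / a + 1) * a ≤ (m % a % d + m % a / d) * a := Nat.mul_le_mul_right _ (by omega)
      nlinarith
    obtain ⟨i, hi⟩ := Nat.exists_eq_add_of_le hq
    refine ⟨i, m % a, hs, ?_⟩
    rw [e]
    rw [hi] at hdiv
    linear_combination -hdiv

/-- Cuts [0, a) into q full blocks of length d and a final block of length r, bounding s % d + s / d
on each. -/
theorem mod_add_div_le {a d q r s : ℕ} (hd : 2 ≤ d) (ha : a = d * q + r) (hr2 : r ≤ d - 1)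
    (hs : s < a) :
    (s / d < q ∧ s + 1 ≤ d * q ∧ s % d + s / d + 2 ≤ d + q) ∨
      (s / d = q ∧ s % d + 1 ≤ r) := by
  have h := Nat.mod_add_div s d
  have hm : s % d < d := Nat.mod_lt _ (by omega)
  have hle : s / d ≤ q := by
    by_contra hc
    have : d * (q + 1) ≤ d * (s / d) := Nat.mul_le_mul_left _ (by omega)
    rw [mul_add] at this
    omega
  rcases hle.lt_or_eq with hlt | heq
  · have : d * (s / d + 1) ≤ d * q := Nat.mul_le_mul_left _ hlt
    rw [mul_add] at this
    exact .inl ⟨hlt, by omega, by omega⟩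
  · rw [heq] at h
    exact .inr ⟨heq, by omega⟩

theorem mod_div_of_eq {d j l : ℕ} (hj : j < d) :
    (j + d * l) % d = j ∧ (j + d * l) / d = l := by
  rw [Nat.add_mul_mod_self_left, Nat.mod_eq_of_lt hj, Nat.add_mul_div_left _ _ (by omega),
    Nat.div_eq_of_lt hj]
  simp

theorem frobeniusNumber_of_le {a d q r : ℕ} (ha3 : 3 ≤ a) (hd : 2 ≤ d)
    (ha : a = d * q + r) (hr1 : 1 ≤ r) (hr2 : r ≤ d - 2) (hsum : d - 2 ≤ q + r) :
    ∃ F : ℕ, FrobeniusNumber F (Set.range ![a, a + 1, a + d]) ∧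
      F + r + 1 = (q + (d - 2)) * a := by
  obtain ⟨b, rfl⟩ : ∃ b, d = b + 2 := ⟨d - 2, by omega⟩
  simp only [Nat.add_sub_cancel] at *
  obtain ⟨F, hF⟩ : ∃ F, (q + b) * a = r + 1 + F := Nat.exists_eq_add_of_le (by
    rcases q with _ | q
    · nlinarith
    · nlinarith)
  refine ⟨F, ?_, by omega⟩
  rcases q with _ | q
  -- With q = 0 the hypotheses force a = r = d - 2, and s₀ = a - 1 is the maximiser.
  · obtain rfl : b = r := by omega
    obtain rfl : a = b := by omega
    obtain ⟨c, rfl⟩ : ∃ c, a = c + 1 := ⟨a - 1, by omega⟩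
    have hm : ∀ s < c + 1, s % (c + 1 + 2) = s ∧ s / (c + 1 + 2) = 0 := fun s hs =>
      ⟨Nat.mod_eq_of_lt (by omega), Nat.div_eq_of_lt (by omega)⟩
    refine frobeniusNumber_of_isMax (s₀ := c) hd ha hr1 (by omega) (by omega) (by omega) ?_ ?_
    · intro s hs
      rw [(hm s hs).1, (hm s hs).2, (hm c (by omega)).1, (hm c (by omega)).2]
      have : s ≤ c := by omega
      gcongr
    · rw [(hm c (by omega)).1, (hm c (by omega)).2]
      zify at *
      linear_combination -hF
  -- The maximiser is the end of the last full block. In the final block s % d + s / d is smaller by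
  -- at least one, and the lost a outweighs any gain in s < a.
  · obtain ⟨h1, h2⟩ := mod_div_of_eq (d := b + 2) (j := b + 1) (l := q) (by omega)
    refine frobeniusNumber_of_isMax (s₀ := b + 1 + (b + 2) * q) hd ha hr1 (by omega) (by omega)
      (by rw [ha]; nlinarith) ?_ ?_
    · intro s hs
      rw [h1, h2]
      rcases mod_add_div_le hd ha (by omega) hs with ⟨-, hs1, hs2⟩ | ⟨hs1, hs2⟩
      · exact Nat.add_le_add (by rw [mul_add] at hs1; omega) (Nat.mul_le_mul_right _ (by omega))
      · have : (s % (b + 2) + s / (b + 2) + 1) * a ≤ (b + 1 + q) * a :=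
          Nat.mul_le_mul_right _ (by omega)
        rw [add_mul, one_mul] at this
        omega
    · rw [h1, h2]
      zify at *
      linear_combination -hF + ha

theorem frobeniusNumber_of_eq {a d q r : ℕ} (ha3 : 3 ≤ a) (hd : 2 ≤ d)
    (ha : a = d * q + r) (hr : r = d - 1) :
    ∃ F : ℕ, FrobeniusNumber F (Set.range ![a, a + 1, a + d]) ∧
      F + 1 = (q + (d - 2)) * a := by
  obtain ⟨b, rfl⟩ : ∃ b, d = b + 2 := ⟨d - 2, by omega⟩
  obtain rfl : r = b + 1 := by omega
  simp only [Nat.add_sub_cancel] at *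
  obtain ⟨F, hF⟩ : ∃ F, (q + b) * a = 1 + F := Nat.exists_eq_add_of_le (by
    have : 1 ≤ q + b := by
      by_contra hc
      obtain ⟨rfl, rfl⟩ : q = 0 ∧ b = 0 := by omega
      omega
    nlinarith)
  refine ⟨F, ?_, by omega⟩
  -- For r = d - 1, s₀ = a - 1 maximises both s and s % d + s / d.
  obtain ⟨h1, h2⟩ := mod_div_of_eq (d := b + 2) (j := b) (l := q) (by omega)
  refine frobeniusNumber_of_isMax (s₀ := b + (b + 2) * q) hd ha (by omega) (by omega) (by omega)
    (by omega) ?_ ?_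
  · intro s hs
    rw [h1, h2]
    refine Nat.add_le_add (by omega) (Nat.mul_le_mul_right _ ?_)
    rcases mod_add_div_le hd ha (by omega) hs with ⟨-, hs1, hs2⟩ | ⟨hs1, hs2⟩ <;> omega
  · rw [h1, h2]
    zify at *
    linear_combination -hF + ha

/-! ### Kernels generated by homogeneous binomials -/

section Kernel

variable {k : Type*} [Field k] {e : ℕ} {n : Fin e → ℕ}

theorem coeff_phi (hn : ∀ i, 0 < n i) (f : MvPowerSeries (Fin e) k) (N : ℕ) :
    PowerSeries.coeff N (phi k n hn f : PowerSeries k) =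
      ∑ᶠ c, if Finsupp.weight n c = N then coeff c f else 0 := by
  change PowerSeries.coeff N
    (MvPowerSeries.substAlgHom (hasSubst_tPow k n hn) f : PowerSeries k) = _
  rw [MvPowerSeries.substAlgHom_apply, PowerSeries.coeff,
    MvPowerSeries.coeff_subst (hasSubst_tPow k n hn)]
  refine finsum_congr fun c => ?_
  have : (c.prod fun s j => (tPow k n s) ^ j) =
      (PowerSeries.X ^ Finsupp.weight n c : PowerSeries k) := by
    rw [Finsupp.weight_apply, Finsupp.sum, ← Finset.prod_pow_eq_pow_sum]
    refine Finset.prod_congr rfl fun s _ => ?_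
    change (PowerSeries.X ^ n s : PowerSeries k) ^ c s = _
    rw [← pow_mul, smul_eq_mul, mul_comm]
  rw [this]
  change coeff c f • PowerSeries.coeff N (PowerSeries.X ^ Finsupp.weight n c : PowerSeries k) = _
  rw [PowerSeries.coeff_X_pow]
  simp [eq_comm]

/-- The homogeneous component of weight `N` of a power series. -/
noncomputable def weightComponent (n : Fin e → ℕ) (N : ℕ) (f : MvPowerSeries (Fin e) k) :
    MvPowerSeries (Fin e) k :=
  fun c => if Finsupp.weight n c = N then coeff c f else 0

theorem coeff_weightComponent (N : ℕ) (f : MvPowerSeries (Fin e) k) (c : Fin e →₀ ℕ) :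
    coeff c (weightComponent n N f) = if Finsupp.weight n c = N then coeff c f else 0 := rfl

/-- An ideal generated by finitely many homogeneous binomials contains a power series as soon as
it contains its homogeneous components. -/
theorem mem_span_of_weightComponent_mem {ι : Type*} [Fintype ι] {u v : ι → Fin e →₀ ℕ}
    (huv : ∀ i, Finsupp.weight n (u i) = Finsupp.weight n (v i)) {f : MvPowerSeries (Fin e) k}
    (hf : ∀ N, weightComponent n N f ∈
      Ideal.span (Set.range fun i => monomial (u i) (1 : k) - monomial (v i) 1)) :
    f ∈ Ideal.span (Set.range fun i => monomial (u i) (1 : k) - monomial (v i) 1) := by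
  simp only [Ideal.mem_span_range_iff_exists_fun] at hf ⊢
  choose h hh using hf
  -- The infinitely many cofactors are glued: a coefficient of g i at c only contributes in weight
  -- wt(c) + wt(u i), so it is taken from the cofactor for that weight.
  obtain ⟨g, hg⟩ : ∃ g : ι → MvPowerSeries (Fin e) k, ∀ i c,
      coeff c (g i) = coeff c (h (Finsupp.weight n c + Finsupp.weight n (u i)) i) :=
    ⟨fun i c => coeff c (h (Finsupp.weight n c + Finsupp.weight n (u i)) i), fun _ _ => rfl⟩
  refine ⟨g, ?_⟩
  ext c
  have hc := congrArg (coeff c) (hh (Finsupp.weight n c))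
  rw [coeff_weightComponent, if_pos rfl] at hc
  rw [← hc, map_sum, map_sum]
  refine Finset.sum_congr rfl fun i _ => ?_
  have key : ∀ w, Finsupp.weight n w = Finsupp.weight n (u i) → w ≤ c →
      Finsupp.weight n (c - w) + Finsupp.weight n (u i) = Finsupp.weight n c := by
    intro w hw hle
    rw [← hw, ← map_add, tsub_add_cancel_of_le hle]
  simp only [mul_sub, map_sub, coeff_mul_monomial, mul_one]
  congr 1
  · split_ifs with hle
    · rw [hg, key _ rfl hle]
    · rfl
  · split_ifs with hle
    · rw [hg, key _ (huv i).symm hle]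
    · rfl

/-- The defining ideal is contained in an ideal generated by finitely many homogeneous binomials
that contains all differences of monomials of equal weight. -/
theorem definingIdeal_le_span (hn : ∀ i, 0 < n i) {ι : Type*} [Fintype ι]
    {u v : ι → Fin e →₀ ℕ} (huv : ∀ i, Finsupp.weight n (u i) = Finsupp.weight n (v i))
    (h : ∀ c c' : Fin e →₀ ℕ, Finsupp.weight n c = Finsupp.weight n c' →
      monomial c (1 : k) - monomial c' 1 ∈
        Ideal.span (Set.range fun i => monomial (u i) (1 : k) - monomial (v i) 1)) :
    definingIdeal k n hn ≤
      Ideal.span (Set.range fun i => monomial (u i) (1 : k) - monomial (v i) 1) := by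
  intro f hf
  refine mem_span_of_weightComponent_mem huv fun N => ?_
  have hfin : {c : Fin e →₀ ℕ | Finsupp.weight n c = N}.Finite :=
    (Finsupp.finite_of_nat_weight_le n (fun i => (hn i).ne') N).subset fun c hc => le_of_eq hc
  have hsum : ∑ c ∈ hfin.toFinset, coeff c f = 0 := by
    have h0 := coeff_phi hn f N
    rw [RingHom.mem_ker.1 hf, ZeroMemClass.coe_zero, map_zero,
      finsum_eq_sum_of_support_subset (s := hfin.toFinset) _ (fun c hc => by
        rw [Set.Finite.coe_toFinset]
        exact by_contra fun hc' => hc (if_neg hc'))] at h0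
    rw [h0]
    refine Finset.sum_congr rfl fun c hc => ?_
    rw [if_pos (by simpa using hc)]
  have hcomp : weightComponent n N f =
      ∑ c ∈ hfin.toFinset, monomial c (coeff c f) := by
    ext c
    rw [coeff_weightComponent, map_sum]
    simp only [coeff_monomial, Finset.sum_ite_eq, Set.Finite.mem_toFinset, Set.mem_ofPred_eq]
  rcases hfin.toFinset.eq_empty_or_nonempty with he | ⟨c₀, hc₀⟩
  · simp [hcomp, he]
  -- The coefficients in each weight sum to zero, so a fixed monomial c₀ can be subtracted from
  -- every term.
  · have : weightComponent n N f = ∑ c ∈ hfin.toFinset,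
        C (coeff c f) * (monomial c (1 : k) - monomial c₀ 1) := by
      simp only [mul_sub, Finset.sum_sub_distrib, ← Finset.sum_mul, ← map_sum, hsum, map_zero,
        zero_mul, sub_zero, hcomp]
      refine Finset.sum_congr rfl fun c _ => ?_
      rw [← smul_eq_C_mul, ← map_smul, smul_eq_mul, mul_one]
    rw [this]
    refine Ideal.sum_mem _ fun c hc => Ideal.mul_mem_left _ _ (h _ _ ?_)
    simp only [Set.Finite.mem_toFinset, Set.mem_ofPred_eq] at hc hc₀
    rw [hc, hc₀]

end Kernel

/-! ### The determinantal ideal -/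

/-- The ideal of maximal minors of a `2 × 3` matrix in terms of its three generators. -/
theorem minorsTwo_two_three {S : Type*} [CommRing S] (M : Matrix (Fin 2) (Fin 3) S) :
    minorsTwo M = Ideal.span (Set.range
      ![M 0 0 * M 1 1 - M 0 1 * M 1 0, M 0 0 * M 1 2 - M 0 2 * M 1 0,
        M 0 1 * M 1 2 - M 0 2 * M 1 1]) := by
  refine le_antisymm (Ideal.span_le.2 ?_) (Ideal.span_le.2 ?_)
  · rintro _ ⟨f, g, rfl⟩
    have hf : f 0 < f 1 := f.strictMono (by decide)
    have hg : g 0 < g 1 := g.strictMono (by decide)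
    rw [Matrix.det_fin_two]
    simp only [Matrix.submatrix_apply]
    have hf' : f 0 = 0 ∧ f 1 = 1 := by omega
    have hg' : (g 0 = 0 ∧ g 1 = 1) ∨ (g 0 = 0 ∧ g 1 = 2) ∨ (g 0 = 1 ∧ g 1 = 2) := by omega
    rw [hf'.1, hf'.2]
    rcases hg' with ⟨h0, h1⟩ | ⟨h0, h1⟩ | ⟨h0, h1⟩ <;> rw [h0, h1]
    · exact Ideal.subset_span ⟨0, rfl⟩
    · exact Ideal.subset_span ⟨1, rfl⟩
    · exact Ideal.subset_span ⟨2, rfl⟩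
  · rintro _ ⟨i, rfl⟩
    have hmem : ∀ g : Fin 2 → Fin 3, StrictMono g →
        M 0 (g 0) * M 1 (g 1) - M 0 (g 1) * M 1 (g 0) ∈ minorsTwo M := fun g hg =>
      Ideal.subset_span ⟨RelEmbedding.refl _, OrderEmbedding.ofStrictMono g hg, by
        rw [Matrix.det_fin_two]; rfl⟩
    fin_cases i
    · exact hmem ![0, 1] (by decide)
    · exact hmem ![0, 2] (by decide)
    · exact hmem ![1, 2] (by decide)

theorem monomial_fin_three {k : Type*} [Field k] (c : Fin 3 →₀ ℕ) :
    monomial c (1 : k) = X 0 ^ c 0 * X 1 ^ c 1 * X 2 ^ c 2 := by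
  rw [monomial_one_eq, Finsupp.prod_fintype _ _ (by simp), Fin.prod_univ_three]

theorem weight_fin_three (n : Fin 3 → ℕ) (c : Fin 3 →₀ ℕ) :
    Finsupp.weight n c = c 0 * n 0 + c 1 * n 1 + c 2 * n 2 := by
  rw [Finsupp.weight_apply, Finsupp.sum_fintype _ _ (by simp), Fin.sum_univ_three]
  rfl

/-- The defining ideal of `⟨a, a + 1, a + d⟩` is generated by three binomials. -/
theorem definingIdeal_eq_span (k : Type*) [Field k] {a d q r : ℕ} (ha3 : 3 ≤ a) (hd : 2 ≤ d)
    (ha : a = d * q + r) (hr1 : 1 ≤ r) (hr2 : r ≤ d - 1) (hsum : d - 2 ≤ q + r) :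
    definingIdeal k ![a, a + 1, a + d] (gens_pos ha3 d) = Ideal.span (Set.range
      ![(X 1 ^ d - X 2 * X 0 ^ (d - 1) : MvPowerSeries (Fin 3) k),
        X 1 ^ r * X 2 ^ q - X 0 ^ (q + r + 1),
        X 2 ^ (q + 1) - X 1 ^ (d - r) * X 0 ^ (q + r + 2 - d)]) := by
  have w1 := weight_rel_one (a := a) hd
  have w2 := weight_rel_two ha
  have w3 := weight_rel_three ha hd hr2 hsum
  set J := Ideal.span (Set.range
      ![(X 1 ^ d - X 2 * X 0 ^ (d - 1) : MvPowerSeries (Fin 3) k),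
        X 1 ^ r * X 2 ^ q - X 0 ^ (q + r + 1),
        X 2 ^ (q + 1) - X 1 ^ (d - r) * X 0 ^ (q + r + 2 - d)]) with hJ
  refine le_antisymm ?_ ?_
  · let u : Fin 3 → Fin 3 →₀ ℕ := fun i => Finsupp.equivFunOnFinite.symm
      (![![0, d, 0], ![0, r, q], ![0, 0, q + 1]] i)
    let v : Fin 3 → Fin 3 →₀ ℕ := fun i => Finsupp.equivFunOnFinite.symm
      (![![d - 1, 0, 1], ![q + r + 1, 0, 0], ![q + r + 2 - d, d - r, 0]] i)
    have hJ' : J = Ideal.span (Set.range fun i => monomial (u i) (1 : k) - monomial (v i) 1) := by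
      rw [hJ]
      congr 2
      funext i
      rw [monomial_fin_three, monomial_fin_three]
      fin_cases i <;> simp [u, v, mul_comm]
    rw [hJ']
    refine definingIdeal_le_span _ (fun i => ?_) fun c c' hcc => ?_
    · rw [weight_fin_three, weight_fin_three]
      fin_cases i <;> simp [u, v] <;> linarith
    rw [← hJ', monomial_fin_three, monomial_fin_three, ← Ideal.Quotient.eq]
    simp only [map_mul, map_pow]
    have rel : ∀ i : Fin 3, Ideal.Quotient.mk J
        (![(X 1 ^ d - X 2 * X 0 ^ (d - 1) : MvPowerSeries (Fin 3) k),
          X 1 ^ r * X 2 ^ q - X 0 ^ (q + r + 1),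
          X 2 ^ (q + 1) - X 1 ^ (d - r) * X 0 ^ (q + r + 2 - d)] i) = 0 := fun i =>
      Ideal.Quotient.eq_zero_iff_mem.2 (Ideal.subset_span ⟨i, rfl⟩)
    have r1 := sub_eq_zero.1 ((map_sub _ _ _).symm.trans (rel 0))
    have r2 := sub_eq_zero.1 ((map_sub _ _ _).symm.trans (rel 1))
    have r3 := sub_eq_zero.1 ((map_sub _ _ _).symm.trans (rel 2))
    simp only [map_mul, map_pow] at r1 r2 r3
    -- Working in the product of the quotient ring with the weights makes a single pair (i, s)
    -- describe both the class of a monomial and its weight.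
    have nf := exists_normalForm
      (M := (MvPowerSeries (Fin 3) k ⧸ J) × Multiplicative ℕ)
      (x := (Ideal.Quotient.mk J (X 0), .ofAdd a))
      (y := (Ideal.Quotient.mk J (X 1), .ofAdd (a + 1)))
      (z := (Ideal.Quotient.mk J (X 2), .ofAdd (a + d))) hd ha hr1 hr2
      (Prod.ext r1 (by simpa only [Prod.snd_mul, Prod.pow_snd, ← ofAdd_nsmul, ← ofAdd_add,
        smul_eq_mul] using congrArg Multiplicative.ofAdd w1))
      (Prod.ext r2 (by simpa only [Prod.snd_mul, Prod.pow_snd, ← ofAdd_nsmul, ← ofAdd_add,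
        smul_eq_mul] using congrArg Multiplicative.ofAdd w2))
      (Prod.ext r3 (by simpa only [Prod.snd_mul, Prod.pow_snd, ← ofAdd_nsmul, ← ofAdd_add,
        smul_eq_mul] using congrArg Multiplicative.ofAdd w3))
    simp only [Prod.ext_iff, Prod.fst_mul, Prod.pow_fst, Prod.snd_mul, Prod.pow_snd,
      ← ofAdd_nsmul, ← ofAdd_add, smul_eq_mul, Multiplicative.ofAdd.injective.eq_iff] at nf
    obtain ⟨i, s, hs, hc, hw⟩ := nf (c 0) (c 1) (c 2)
    obtain ⟨i', s', hs', hc', hw'⟩ := nf (c' 0) (c' 1) (c' 2)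
    rw [weight_fin_three, weight_fin_three] at hcc
    obtain ⟨rfl, rfl⟩ := normalForm_injective hs hs' (hw.symm.trans (hcc.trans hw'))
    exact hc.trans hc'.symm
  · refine Ideal.span_le.2 ?_
    rintro _ ⟨i, rfl⟩
    refine RingHom.mem_ker.2 (Subtype.ext ?_)
    have hX : ∀ i, ((phi k ![a, a + 1, a + d] (gens_pos ha3 d) (X i) :
        semigroupRing k (semigroup ![a, a + 1, a + d])) : PowerSeries k) =
        PowerSeries.X ^ (![a, a + 1, a + d] i) := phi_X k _ (gens_pos ha3 d)
    have p1 := congrArg (fun m => (PowerSeries.X ^ m : PowerSeries k)) w1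
    have p2 := congrArg (fun m => (PowerSeries.X ^ m : PowerSeries k)) w2
    have p3 := congrArg (fun m => (PowerSeries.X ^ m : PowerSeries k)) w3
    fin_cases i <;>
      simp [hX, ← pow_mul, ← pow_add, mul_comm, sub_eq_zero] <;> ring_nf at p1 p2 p3 ⊢ <;>
      assumption

end NumSemigroup

theorem mainTheorem1 (k : Type*) [Field k] (a d q r : ℕ) (ha : 3 ≤ a) (hd : 2 ≤ d)
    (hgcd : Nat.gcd a d = 1) (hqr : a = d * q + r) (hr1 : 1 ≤ r) (hr2 : r ≤ d - 1)
    (hsum : d - 2 ≤ q + r) :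
    NumSemigroup.definingIdeal k ![a, a + 1, a + d] (NumSemigroup.gens_pos ha d) =
      NumSemigroup.minorsTwo
        !![(MvPowerSeries.X 1 : MvPowerSeries (Fin 3) k) ^ r, MvPowerSeries.X 2,
            MvPowerSeries.X 0 ^ (q + r + 2 - d);
          MvPowerSeries.X 0 ^ (d - 1), MvPowerSeries.X 1 ^ (d - r), MvPowerSeries.X 2 ^ q] ∧
    (¬ NumSemigroup.IsSymmetric (NumSemigroup.semigroup ![a, a + 1, a + d]) →
      ∃ F : ℕ, FrobeniusNumber F (Set.range ![a, a + 1, a + d]) ∧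
        (r ≤ d - 2 →
          (F : ℚ) = (1 / d) * (a : ℚ) ^ 2 + (((d : ℚ) ^ 2 - 2 * d - r) / d) * a - (r + 1)) ∧
        (r = d - 1 →
          (F : ℚ) = (1 / d) * (a : ℚ) ^ 2 + (((d : ℚ) ^ 2 - 3 * d + 1) / d) * a - 1)) := by

  refine ⟨?_, fun _ => ?_⟩
  · rw [NumSemigroup.definingIdeal_eq_span k ha hd hqr hr1 hr2 hsum,
      NumSemigroup.minorsTwo_two_three]
    congr 2
    have e1 : r + (d - r) = d := by omega
    have e2 : q + r + 2 - d + (d - 1) = q + r + 1 := by omega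
    funext i
    fin_cases i
    · simp [← pow_add, e1]
    · simp [← pow_add, e2]
    · simp [pow_succ', mul_comm]
  · have hd0 : (d : ℚ) ≠ 0 := by positivity
    have hqr' : (a : ℚ) = d * q + r := by exact_mod_cast hqr
    have hd2 : ((d - 2 : ℕ) : ℚ) = d - 2 := by push_cast [hd]; rfl
    rcases (show r ≤ d - 2 ∨ r = d - 1 by omega) with h | h
    · obtain ⟨F, hF, hFeq⟩ := NumSemigroup.frobeniusNumber_of_le ha hd hqr hr1 h hsum
      refine ⟨F, hF, fun _ => ?_, fun h' => by omega⟩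
      have hq : (F : ℚ) + r + 1 = (q + (d - 2)) * a := by rw [← hd2]; exact_mod_cast hFeq
      field_simp
      -- The closed form comes from eliminating q through dq = a - r.
      linear_combination d * hq - a * hqr'
    · obtain ⟨F, hF, hFeq⟩ := NumSemigroup.frobeniusNumber_of_eq ha hd hqr h
      refine ⟨F, hF, fun h' => by omega, fun _ => ?_⟩
      have hq : (F : ℚ) + 1 = (q + (d - 2)) * a := by rw [← hd2]; exact_mod_cast hFeq
      have hr : (r : ℚ) = d - 1 := by
        rw [h, Nat.cast_sub (by omega), Nat.cast_one]
      field_simp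
      linear_combination d * hq - a * hqr' - a * hr
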